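/- Let $\mathcal H$ be a separable complex Hilbert space and let $(X,\mathcal M,\mu)$ be a positive, $\sigma$-finite, complete measure space for which $L^2(X)$ is separable. For $\phi\in L^\infty(X)$ let $M_\phi$ be the multiplication operator $(M_\phi\varphi)(x)=\phi(x)\varphi(x)$ on $L^2(X;\mathcal H)$. A closed subspace $V\subset L^2(X;\mathcal H)$ is called multiplication-invariant (MI) if $M_\phi V\subset V$ for all $\phi\in L^\infty(X)$, and a bounded linear operator $T\colon V\to V$ on an MI space is called an MI operator if $TM_\phi=M_\phi T$ for all $\phi\in L^\infty(X)$. A range function is a map $J$ from $X$ to the closed subspaces of $\mathcal H$; it is measurable if $x\mapsto\langle P_J(x)u,v\rangle$ is measurable for all $u,v\in\mathcal H$, where $P_J(x)$ is the orthogonal projection onto $J(x)$. Put $V_J=\{\varphi\in L^2(X;\mathcal H):\varphi(x)\in J(x)\text{ for a.e. }x\}$. A bounded measurable range operator $R\colon J\to J$ is a choice of bounded linear operators $R(x)\colon J(x)\to J(x)$, $x\in X$, such that $\operatorname{ess\,sup}_{x}\|R(x)\|<\infty$ and $x\mapsto\langle R(x)P_J(x)u,v\rangle$ is measurable for all $u,v\in\mathcal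 H$. We write $T=\int_X^\oplus R(x)\,d\mu(x)$ if $(T\varphi)(x)=R(x)[\varphi(x)]$ for a.e. $x$, for every $\varphi\in V_J$. **Theorem.** Let $V$ be an MI space with measurable range function $J$ (so $V=V_J$), let $T\colon V\to V$ be an MI operator, and let $R\colon J\to J$ be its bounded measurable range operator, so that $T=\int_X^\oplus R(x)\,d\mu(x)$. Then: (i) For all real numbers $A\le B$, $T$ is self-adjoint with $\sigma(T)\subset[A,B]$ if and only if, for a.e. $x\in X$, $R(x)$ is self-adjoint with $\sigma(R(x))\subset[A,B]$. (ii) For every compact set $K\subset\mathbb C$, $T$ is normal with $\sigma(T)\subset K$ if and only if, for a.e. $x\in X$, $R(x)$ is normal with $\sigma(R(x))\subset K$. -/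

import Mathlib

open MeasureTheory Filter
open scoped ENNReal

noncomputable section

namespace MultInv

instance {E : Type*} [NormedAddCommGroup E] [InnerProductSpace ℂ E] [CompleteSpace E]
    (K : ClosedSubmodule ℂ E) : CompleteSpace K.toSubmodule :=
  K.isClosed.completeSpace_coe

variable {X : Type*} [MeasurableSpace X] {H : Type*} [NormedAddCommGroup H]
  [InnerProductSpace ℂ H]

/-- The multiplication operator `M_φ` on `L²(X; H)` given by `φ ∈ L^∞(X)`:
`(M_φ f)(x) = φ(x) f(x)` for almost every `x`. -/
def multOp (μ : Measure X) (φ : Lp ℂ ∞ μ) : Lp H 2 μ →L[ℂ] Lp H 2 μ :=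
  (ContinuousLinearMap.lsmul ℂ ℂ : ℂ →L[ℂ] H →L[ℂ] H).holderL μ ∞ 2 2 φ

theorem multOp_ae (μ : Measure X) (φ : Lp ℂ ∞ μ) (f : Lp H 2 μ) :
    ∀ᵐ x ∂μ, multOp μ φ f x = φ x • f x :=
  ContinuousLinearMap.coeFn_holder (r := 2)
    (ContinuousLinearMap.lsmul ℂ ℂ : ℂ →L[ℂ] H →L[ℂ] H) φ f

/-- A closed subspace `V` of `L²(X; H)` is multiplication-invariant if `M_φ V ⊆ V` for every
`φ ∈ L^∞(X)`. -/
def IsMISpace (μ : Measure X) (V : ClosedSubmodule ℂ (Lp H 2 μ)) : Prop :=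
  ∀ φ : Lp ℂ ∞ μ, ∀ f ∈ V, multOp μ φ f ∈ V

/-- A bounded linear operator `T : V → V` on a multiplication-invariant space `V` is a
multiplication-invariant operator if `T M_φ = M_φ T` for every `φ ∈ L^∞(X)`. -/
def IsMIOperator (μ : Measure X) {V : ClosedSubmodule ℂ (Lp H 2 μ)} (hV : IsMISpace μ V)
    (T : V.toSubmodule →L[ℂ] V.toSubmodule) : Prop :=
  ∀ (φ : Lp ℂ ∞ μ) (f : V.toSubmodule),
    (T ⟨multOp μ φ (f : Lp H 2 μ), hV φ f f.2⟩ : Lp H 2 μ) = multOp μ φ (T f : Lp H 2 μ)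

/-- The closed subspace `V_J = {f ∈ L²(X; H) : f(x) ∈ J(x) for a.e. x}` of `L²(X; H)` given by a
range function `J`. -/
def rangeSpace (μ : Measure X) (J : X → ClosedSubmodule ℂ H) :
    ClosedSubmodule ℂ (Lp H 2 μ) where
  carrier := {f | ∀ᵐ x ∂μ, f x ∈ J x}
  add_mem' := by
    intro f g hf hg
    filter_upwards [hf, hg, Lp.coeFn_add f g] with x hfx hgx h
    rw [h]
    exact add_mem hfx hgx
  zero_mem' := by
    filter_upwards [Lp.coeFn_zero H 2 μ] with x h
    rw [h]
    exact zero_mem _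
  smul_mem' := by
    intro c f hf
    filter_upwards [hf, Lp.coeFn_smul c f] with x hfx h
    rw [h]
    exact SMulMemClass.smul_mem c hfx
  isClosed' := by
    refine IsSeqClosed.isClosed fun u f hu hf => ?_
    obtain ⟨ns, -, hns⟩ := (tendstoInMeasure_of_tendsto_Lp hf).exists_seq_tendsto_ae
    have hu' : ∀ᵐ x ∂μ, ∀ n, u n x ∈ J x := ae_all_iff.2 hu
    filter_upwards [hns, hu'] with x hx hux
    exact (J x).isClosed.mem_of_tendsto hx (Eventually.of_forall fun n => hux (ns n))

theorem mem_rangeSpace {μ : Measure X} {J : X → ClosedSubmodule ℂ H} {f : Lp H 2 μ} :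
    f ∈ rangeSpace μ J ↔ ∀ᵐ x ∂μ, f x ∈ J x :=
  Iff.rfl

variable [CompleteSpace H]

/-- A range function `J` is measurable if `x ↦ ⟨P_J(x) u, v⟩` is measurable for all `u, v ∈ H`,
where `P_J(x)` is the orthogonal projection of `H` onto `J(x)`. -/
def MeasurableRangeFunction (J : X → ClosedSubmodule ℂ H) : Prop :=
  ∀ u v : H, Measurable fun x => inner ℂ v ((J x).toSubmodule.starProjection u)

/-- A range operator `R : J → J` is measurable if `x ↦ ⟨R(x) P_J(x) u, v⟩` is measurable for all
`u, v ∈ H`. -/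
def MeasurableRangeOperator {J : X → ClosedSubmodule ℂ H} (R : ∀ x, (J x).toSubmodule →L[ℂ] (J x).toSubmodule) : Prop :=
  ∀ u v : H, Measurable fun x =>
    inner ℂ v (R x ((J x).toSubmodule.orthogonalProjectionOnto u) : H)

/-- A range operator `R` is bounded if the essential supremum of `x ↦ ‖R(x)‖` is finite. -/
def BoundedRangeOperator (μ : Measure X) {J : X → ClosedSubmodule ℂ H}
    (R : ∀ x, (J x).toSubmodule →L[ℂ] (J x).toSubmodule) : Prop :=
  essSup (fun x => ‖R x‖ₑ) μ < ∞

/-- `T = ∫^⊕ R(x) dμ(x)`: for every `f ∈ V` one has `f(x) ∈ J(x)` and `(T f)(x) = R(x) [f(x)]` for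
almost every `x`. -/
def IsDirectIntegral (μ : Measure X) {V : ClosedSubmodule ℂ (Lp H 2 μ)}
    {J : X → ClosedSubmodule ℂ H} (T : V.toSubmodule →L[ℂ] V.toSubmodule) (R : ∀ x, (J x).toSubmodule →L[ℂ] (J x).toSubmodule) : Prop :=
  ∀ f : V.toSubmodule, ∀ᵐ x ∂μ, ∃ h : (f : Lp H 2 μ) x ∈ J x, (T f : Lp H 2 μ) x = R x ⟨(f : Lp H 2 μ) x, h⟩

end MultInv

end

open MeasureTheory Filter
open scoped ENNReal InnerProductSpace

namespace MultInv

/-! ### Lower bounds and spectra of normal operators -/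

section Normal

variable {E : Type*} [NormedAddCommGroup E] [InnerProductSpace ℂ E] [CompleteSpace E]

/-! For a normal operator, having spectrum in a closed set `K` amounts to countably many lower
bounds `q * ‖u‖ ≤ ‖(T - c) u‖`, one for each ball `B(c, q)` from a countable family that misses `K`
(`spectrum_subset_iff_le_norm`). Countability lets these conditions commute with "for a.e. `x`", so
the spectrum of `T` is never compared directly with those of the `R x`.

Each bound, and each operator identity, holds for `T` iff it holds in a.e. fibre: indicator cutoffs
turn global statements into pointwise ones, and a sequence in `V_J` with dense values extends these
to whole fibres (`exists_seq_dense_fibres`, `le_norm_iff`, `ae_iff`). As `star T` has fibres `star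
(R x)` (`adjoint`), normality and self-adjointness transfer too. Part (i) is (ii) for a real
interval, restricted to self-adjoint operators. -/

theorem isUnit_of_isStarNormal_of_le_norm {T : E →L[ℂ] E} (hT : IsStarNormal T) {r : ℝ}
    (hr : 0 < r) (h : ∀ u, r * ‖u‖ ≤ ‖T u‖) : IsUnit T := by
  rw [ContinuousLinearMap.isUnit_iff_bijective,
    ContinuousLinearMap.bijective_iff_dense_range_and_antilipschitz]
  refine ⟨?_, ⟨r⁻¹, by positivity⟩, ?_⟩
  -- Normality makes the orthogonal complement of the range equal to the kernel, so injectivity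
  -- gives dense range.
  · rw [Submodule.topologicalClosure_eq_top_iff, ContinuousLinearMap.IsStarNormal.orthogonal_range hT,
      LinearMap.ker_eq_bot']
    intro u hu
    have h1 := h u
    have h2 : T u = 0 := hu
    rw [h2, norm_zero] at h1
    exact norm_le_zero_iff.1 (nonpos_of_mul_nonpos_right h1 hr)
  · refine AddMonoidHomClass.antilipschitz_of_bound T fun u => ?_
    change ‖u‖ ≤ r⁻¹ * ‖T u‖
    rw [inv_mul_eq_div, le_div_iff₀' hr]
    exact h u

theorem isStarNormal_sub_algebraMap {T : E →L[ℂ] E} (hT : IsStarNormal T) (l : ℂ) :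
    IsStarNormal (T - algebraMap ℂ _ l) := by
  refine ⟨?_⟩
  rw [star_sub, ← algebraMap_star_comm]
  exact (hT.star_comm_self.sub_right (Algebra.commutes l _).symm).sub_left
    (Commute.sub_right (Algebra.commutes _ _) (Algebra.commutes _ _))

/-- The inverse of `T - l` is normal, so its norm is its spectral radius, and its spectrum consists
of inverses of numbers of modulus at least `r`. -/
theorem le_norm_of_ball_disjoint_spectrum {T : E →L[ℂ] E} (hT : IsStarNormal T) {l : ℂ} {r : ℝ}
    (hr : 0 < r) (h : Disjoint (Metric.ball l r) (spectrum ℂ T)) (u : E) :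
    r * ‖u‖ ≤ ‖(T - algebraMap ℂ _ l) u‖ := by
  have hl : l ∉ spectrum ℂ T := Set.disjoint_left.1 h (Metric.mem_ball_self hr)
  have hU : IsUnit (T - algebraMap ℂ _ l) := by
    rw [spectrum.notMem_iff] at hl
    rw [← neg_sub]
    exact hl.neg
  obtain ⟨U, hU⟩ := hU
  have hN : IsStarNormal (T - algebraMap ℂ (E →L[ℂ] E) l) :=
    isStarNormal_sub_algebraMap hT l
  have hN' : IsStarNormal (↑U⁻¹ : E →L[ℂ] E) := by
    rw [← hU] at hN
    have hUn : IsStarNormal U := ⟨by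
      have := hN.star_comm_self
      rw [commute_iff_eq] at this ⊢
      ext1
      simpa using this⟩
    have := hUn.star_comm_self.inv_inv
    refine ⟨?_⟩
    rw [commute_iff_eq] at this ⊢
    have := congrArg Units.val this
    simpa using this
  have hs : spectralRadius ℂ (↑U⁻¹ : E →L[ℂ] E) ≤ ENNReal.ofReal r⁻¹ := by
    refine iSup₂_le fun k hk => ?_
    rw [← spectrum.map_inv, Set.mem_inv, hU] at hk
    have h0 : k⁻¹ + l ∈ spectrum ℂ T := by
      have := spectrum.add_mem_add_iff (s := l) |>.2 hk
      rwa [add_sub_cancel] at this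
    have h1 : r ≤ ‖k⁻¹‖ := by
      by_contra hlt
      exact Set.disjoint_left.1 h (by simpa using hlt) h0
    rw [norm_inv] at h1
    rw [← enorm_eq_nnnorm, ← ofReal_norm]
    refine ENNReal.ofReal_le_ofReal ?_
    exact (le_inv_comm₀ hr (inv_pos.1 (hr.trans_le h1))).1 h1
  rw [IsStarNormal.spectralRadius_eq_nnnorm, ← enorm_eq_nnnorm, ← ofReal_norm,
    ENNReal.ofReal_le_ofReal_iff (by positivity)] at hs
  rw [← hU]
  have h2 : (↑U⁻¹ : E →L[ℂ] E) ((U : E →L[ℂ] E) u) = u := by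
    rw [← mul_apply_eq_comp, Units.inv_mul, one_apply_eq_self]
  have h3 := (↑U⁻¹ : E →L[ℂ] E).le_of_opNorm_le hs ((U : E →L[ℂ] E) u)
  rw [h2, inv_mul_eq_div, le_div_iff₀' hr] at h3
  exact h3

/-- A normal operator has spectrum in a closed set `K` iff `T - l` is bounded below by `r` for every
ball `B(l, r)` disjoint from `K` with centre in a dense sequence and rational radius. -/
theorem spectrum_subset_iff_le_norm {T : E →L[ℂ] E} (hT : IsStarNormal T) {K : Set ℂ}
    (hK : IsClosed K) :
    spectrum ℂ T ⊆ K ↔ ∀ (n : ℕ) (q : ℚ), 0 < q →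
      Disjoint (Metric.ball (TopologicalSpace.denseSeq ℂ n) q) K →
      ∀ u, (q : ℝ) * ‖u‖ ≤ ‖(T - algebraMap ℂ _ (TopologicalSpace.denseSeq ℂ n)) u‖ := by
  refine ⟨fun h n q hq hd => le_norm_of_ball_disjoint_spectrum hT (by exact_mod_cast hq)
    (hd.mono_right h), fun h l hl => ?_⟩
  by_contra hlK
  obtain ⟨ε, hε, hball⟩ := Metric.isOpen_iff.1 hK.isOpen_compl l hlK
  obtain ⟨q, hq0, hqε⟩ := exists_rat_btwn (half_pos hε)
  obtain ⟨n, hn⟩ := Metric.denseRange_iff.1 (TopologicalSpace.denseRange_denseSeq ℂ) l q hq0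
  set c := TopologicalSpace.denseSeq ℂ n with hc
  have hd : Disjoint (Metric.ball c q) K := by
    refine Set.disjoint_left.2 fun z hz hzK => hball ?_ hzK
    have := dist_triangle_right z l c
    rw [Metric.mem_ball] at hz ⊢
    linarith
  have hb := h n q (by exact_mod_cast hq0) hd
  -- The bound at `c` survives the move to `l` because `dist l c < q` strictly.
  have hlow : ∀ u, ((q : ℝ) - dist l c) * ‖u‖ ≤ ‖(T - algebraMap ℂ _ l) u‖ := by
    intro u
    have h1 : (T - algebraMap ℂ (E →L[ℂ] E) c) u = (T - algebraMap ℂ _ l) u + (l - c) • u := by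
      simp [Algebra.algebraMap_eq_smul_one, sub_smul]
    have h2 := norm_add_le ((T - algebraMap ℂ (E →L[ℂ] E) l) u) ((l - c) • u)
    rw [← h1, norm_smul, ← dist_eq_norm] at h2
    have := hb u
    linarith
  have hN : IsStarNormal (T - algebraMap ℂ (E →L[ℂ] E) l) :=
    isStarNormal_sub_algebraMap hT l
  refine spectrum.mem_iff.1 hl ?_
  rw [← neg_sub]
  exact (isUnit_of_isStarNormal_of_le_norm hN (sub_pos.2 hn) hlow).neg

end Normal

/-! ### Weak and strong measurability -/

section Measurability

variable {X : Type*} [MeasurableSpace X] {H : Type*} [NormedAddCommGroup H]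
  [InnerProductSpace ℂ H] [TopologicalSpace.SeparableSpace H]

/-- Makes the preimage of a closed ball a countable intersection of sets given by scalar inner
products. -/
theorem norm_le_iff_forall_denseSeq_inner {w : H} {r : ℝ} :
    ‖w‖ ≤ r ↔ 0 ≤ r ∧ ∀ n, ‖⟪TopologicalSpace.denseSeq H n, w⟫_ℂ‖ ≤
      ‖TopologicalSpace.denseSeq H n‖ * r := by
  constructor
  · intro h
    exact ⟨(norm_nonneg _).trans h, fun n => (norm_inner_le_norm _ _).trans (by gcongr)⟩
  · rintro ⟨hr, h⟩
    have h1 : ∀ v : H, ‖⟪v, w⟫_ℂ‖ ≤ ‖v‖ * r := by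
      intro v
      refine (TopologicalSpace.denseRange_denseSeq H).induction_on (p := fun v : H =>
        ‖⟪v, w⟫_ℂ‖ ≤ ‖v‖ * r) v ?_ h
      exact isClosed_le (by fun_prop) (by fun_prop)
    by_contra! hlt
    have h2 := h1 w
    rw [inner_self_eq_norm_sq_to_K, norm_pow, RCLike.norm_ofReal, abs_norm] at h2
    nlinarith

/-- A weakly measurable function into a separable inner product space is strongly measurable. -/
theorem stronglyMeasurable_of_inner {f : X → H} (hf : ∀ v : H, Measurable fun x => ⟪v, f x⟫_ℂ) :
    StronglyMeasurable f := by
  borelize H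
  refine Measurable.stronglyMeasurable (measurable_of_isOpen fun U hU => ?_)
  have hball : ∀ (c : H) (r : ℝ), MeasurableSet (f ⁻¹' Metric.closedBall c r) := by
    intro c r
    have : f ⁻¹' Metric.closedBall c r = {x | 0 ≤ r ∧ ∀ n,
        ‖⟪TopologicalSpace.denseSeq H n, f x - c⟫_ℂ‖ ≤ ‖TopologicalSpace.denseSeq H n‖ * r} := by
      ext x
      rw [Set.mem_preimage, mem_closedBall_iff_norm, norm_le_iff_forall_denseSeq_inner]
      rfl
    rw [this]
    rw [Set.ofPred_and, Set.ofPred_forall]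
    refine (MeasurableSet.const _).inter (MeasurableSet.iInter fun n => ?_)
    refine measurableSet_le (Measurable.norm ?_) measurable_const
    simp only [inner_sub_right]
    exact (hf _).sub measurable_const
  have hU' : f ⁻¹' U = ⋃ (n : ℕ) (q : ℚ) (_ : Metric.closedBall (TopologicalSpace.denseSeq H n) q ⊆ U),
      f ⁻¹' Metric.closedBall (TopologicalSpace.denseSeq H n) q := by
    ext x
    simp only [Set.mem_iUnion, Set.mem_preimage]
    refine ⟨fun hx => ?_, fun ⟨n, q, h, hx⟩ => h hx⟩
    obtain ⟨ε, hε, hb⟩ := Metric.isOpen_iff.1 hU _ hx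
    obtain ⟨q, hq0, hqε⟩ := exists_rat_btwn (half_pos hε)
    obtain ⟨n, hn⟩ := Metric.denseRange_iff.1 (TopologicalSpace.denseRange_denseSeq H) (f x) q hq0
    refine ⟨n, q, fun z hz => hb ?_, hn.le⟩
    have := dist_triangle_right z (f x) (TopologicalSpace.denseSeq H n)
    rw [Metric.mem_closedBall] at hz
    rw [Metric.mem_ball]
    linarith
  rw [hU']
  exact .iUnion fun n => .iUnion fun q => .iUnion fun _ => hball _ _

end Measurability

/-! ### Passing between an operator and its fibres -/

section DirectIntegral

variable {X : Type*} [MeasurableSpace X] {μ : Measure X} {H : Type*} [NormedAddCommGroup H]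
  [InnerProductSpace ℂ H] {J : X → ClosedSubmodule ℂ H}

/-- The product of an element of `V_J` with the indicator function of a measurable set. -/
noncomputable def cutoff (f : (rangeSpace μ J).toSubmodule) {s : Set X} (hs : MeasurableSet s) :
    (rangeSpace μ J).toSubmodule :=
  ⟨((Lp.memLp (f : Lp H 2 μ)).indicator hs).toLp, by
    change ∀ᵐ x ∂μ, _ ∈ J x
    filter_upwards [((Lp.memLp (f : Lp H 2 μ)).indicator hs).coeFn_toLp, mem_rangeSpace.1 f.2]
      with x hx hfx
    rw [hx]
    by_cases hxs : x ∈ s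
    · rwa [Set.indicator_of_mem hxs]
    · rw [Set.indicator_of_notMem hxs]
      exact zero_mem _⟩

theorem cutoff_ae (f : (rangeSpace μ J).toSubmodule) {s : Set X} (hs : MeasurableSet s) :
    (cutoff f hs : Lp H 2 μ) =ᵐ[μ] s.indicator (f : Lp H 2 μ) :=
  ((Lp.memLp (f : Lp H 2 μ)).indicator hs).coeFn_toLp

theorem inner_cutoff_left (f g : (rangeSpace μ J).toSubmodule) {s : Set X} (hs : MeasurableSet s) :
    ⟪cutoff f hs, g⟫_ℂ = ∫ x in s, ⟪(f : Lp H 2 μ) x, (g : Lp H 2 μ) x⟫_ℂ ∂μ := by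
  rw [Submodule.coe_inner, L2.inner_def, ← integral_indicator hs]
  refine integral_congr_ae ?_
  filter_upwards [cutoff_ae f hs] with x hx
  rw [hx]
  by_cases hxs : x ∈ s <;> simp [hxs]

theorem norm_cutoff_sq (f : (rangeSpace μ J).toSubmodule) {s : Set X} (hs : MeasurableSet s) :
    ‖cutoff f hs‖ ^ 2 = ∫ x in s, ‖(f : Lp H 2 μ) x‖ ^ 2 ∂μ := by
  refine Complex.ofReal_injective ?_
  rw [← integral_complex_ofReal, Complex.ofReal_pow]
  refine (inner_self_eq_norm_sq_to_K (𝕜 := ℂ) (cutoff f hs)).symm.trans ?_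
  rw [inner_cutoff_left]
  refine setIntegral_congr_ae hs ?_
  filter_upwards [cutoff_ae f hs] with x hx hxs
  rw [hx, Set.indicator_of_mem hxs, Complex.ofReal_pow]
  exact inner_self_eq_norm_sq_to_K _

/-- `V_J` contains a sequence whose values are dense in almost every fibre `J(x)`. -/
theorem exists_seq_dense_fibres [CompleteSpace H] [TopologicalSpace.SeparableSpace H]
    [SigmaFinite μ] (hJ : MeasurableRangeFunction J) :
    ∃ F : ℕ × ℕ → (rangeSpace μ J).toSubmodule, ∀ᵐ x ∂μ,
      ∃ h : ∀ i, (F i : Lp H 2 μ) x ∈ J x,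
        DenseRange fun i => (⟨(F i : Lp H 2 μ) x, h i⟩ : (J x).toSubmodule) := by
  let P : ℕ → X → H := fun n x => (J x).toSubmodule.starProjection (TopologicalSpace.denseSeq H n)
  have hP : ∀ n, StronglyMeasurable (P n) := fun n =>
    stronglyMeasurable_of_inner fun v => hJ (TopologicalSpace.denseSeq H n) v
  -- Projections of a fixed vector are bounded, so cutting off to a set of finite measure puts them
  -- in `L²`.
  have hmem : ∀ i : ℕ × ℕ, MemLp ((spanningSets μ i.2).indicator (P i.1)) 2 μ := by
    intro i
    rw [memLp_indicator_iff_restrict (measurableSet_spanningSets μ i.2)]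
    have : IsFiniteMeasure (μ.restrict (spanningSets μ i.2)) :=
      ⟨by simpa using measure_spanningSets_lt_top μ i.2⟩
    exact MemLp.of_bound (hP i.1).aestronglyMeasurable ‖TopologicalSpace.denseSeq H i.1‖
      (.of_forall fun x => (J x).toSubmodule.norm_starProjection_apply_le _)
  have hmemJ : ∀ i : ℕ × ℕ, ∀ x, (spanningSets μ i.2).indicator (P i.1) x ∈ J x := by
    intro i x
    by_cases hx : x ∈ spanningSets μ i.2
    · rw [Set.indicator_of_mem hx]
      exact (J x).toSubmodule.starProjection_apply_mem _
    · rw [Set.indicator_of_notMem hx]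
      exact zero_mem _
  have hae : ∀ᵐ x ∂μ, ∀ i, (hmem i).toLp _ x = (spanningSets μ i.2).indicator (P i.1) x :=
    ae_all_iff.2 fun i => (hmem i).coeFn_toLp
  refine ⟨fun i => ⟨(hmem i).toLp, ?_⟩, ?_⟩
  · change ∀ᵐ x ∂μ, _ ∈ J x
    filter_upwards [hae] with x hx
    rw [hx]
    exact hmemJ i x
  · filter_upwards [hae] with x hx
    simp only [hx]
    refine ⟨fun i => hmemJ i x, fun ⟨u, hu⟩ => ?_⟩
    rw [closure_subtype, ← Set.range_comp]
    obtain ⟨k, hk⟩ := Set.mem_iUnion.1 ((iUnion_spanningSets μ).symm ▸ Set.mem_univ x)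
    have hu' : (J x).toSubmodule.starProjection u = u :=
      Submodule.starProjection_eq_self_iff.2 hu
    have h1 : u ∈ (J x).toSubmodule.starProjection ''
        closure (Set.range (TopologicalSpace.denseSeq H)) :=
      -- The projection is continuous and fixes `u`, so projected dense vectors accumulate at `u`;
      -- the cutoff to the `k`-th set is invisible at `x`.
      ⟨u, TopologicalSpace.denseRange_denseSeq H u, hu'⟩
    refine closure_mono ?_ (image_closure_subset_closure_image
      (J x).toSubmodule.starProjection.continuous h1)
    rintro _ ⟨_, ⟨n, rfl⟩, rfl⟩
    exact ⟨(n, k), by simp [hk, P]⟩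

variable {T S : (rangeSpace μ J).toSubmodule →L[ℂ] (rangeSpace μ J).toSubmodule}
  {R Q : ∀ x, (J x).toSubmodule →L[ℂ] (J x).toSubmodule}

theorem IsDirectIntegral.comp (hT : IsDirectIntegral μ T R) (hS : IsDirectIntegral μ S Q) :
    IsDirectIntegral μ (T * S) fun x => R x * Q x := by
  intro f
  filter_upwards [hT (S f), hS f] with x ⟨h1, h2⟩ ⟨h3, h4⟩
  refine ⟨h3, ?_⟩
  simp only [h4] at h2
  exact h2

theorem IsDirectIntegral.sub_algebraMap (hT : IsDirectIntegral μ T R) (l : ℂ) :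
    IsDirectIntegral μ (T - algebraMap ℂ _ l) fun x => R x - algebraMap ℂ _ l := by
  intro f
  have h : (((T - algebraMap ℂ _ l) f : (rangeSpace μ J).toSubmodule) : Lp H 2 μ)
      = (T f : Lp H 2 μ) - l • (f : Lp H 2 μ) := by
    simp [Algebra.algebraMap_eq_smul_one]
  rw [h]
  filter_upwards [hT f, Lp.coeFn_sub (T f : Lp H 2 μ) (l • (f : Lp H 2 μ)),
    Lp.coeFn_smul l (f : Lp H 2 μ)] with x ⟨h1, h2⟩ h3 h4
  refine ⟨h1, ?_⟩
  rw [h3, Pi.sub_apply, h4, h2]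
  simp [Algebra.algebraMap_eq_smul_one]

theorem IsDirectIntegral.congr_fibres (hT : IsDirectIntegral μ T R) (hS : IsDirectIntegral μ S Q)
    (h : ∀ᵐ x ∂μ, R x = Q x) : T = S := by
  ext1 f
  refine Subtype.ext (Lp.ext ?_)
  filter_upwards [hT f, hS f, h] with x ⟨h1, h2⟩ ⟨h3, h4⟩ h5
  rw [h2, h4, h5]

theorem IsDirectIntegral.map_cutoff (hT : IsDirectIntegral μ T R) (f : (rangeSpace μ J).toSubmodule)
    {s : Set X} (hs : MeasurableSet s) : T (cutoff f hs) = cutoff (T f) hs := by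
  refine Subtype.ext (Lp.ext ?_)
  filter_upwards [hT f, hT (cutoff f hs), cutoff_ae f hs, cutoff_ae (T f) hs]
    with x ⟨h1, h2⟩ ⟨h3, h4⟩ h5 h6
  rw [h4, h6]
  by_cases hx : x ∈ s
  · simp only [h5, Set.indicator_of_mem hx, h2]
  · simp only [h5, Set.indicator_of_notMem hx]
    exact congrArg Subtype.val (map_zero (R x))

variable [CompleteSpace H] [TopologicalSpace.SeparableSpace H] [SigmaFinite μ]

theorem IsDirectIntegral.fibres_ae_eq (hJ : MeasurableRangeFunction J)
    (hT : IsDirectIntegral μ T R) (hT' : IsDirectIntegral μ T Q) : ∀ᵐ x ∂μ, R x = Q x := by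
  obtain ⟨F, hF⟩ := exists_seq_dense_fibres (μ := μ) hJ
  filter_upwards [hF, ae_all_iff.2 fun i => hT (F i), ae_all_iff.2 fun i => hT' (F i)]
    with x ⟨hx, hd⟩ h1 h2
  ext1 u
  refine hd.induction_on (p := fun u => R x u = Q x u) u
    (isClosed_eq (R x).continuous (Q x).continuous) fun i => ?_
  obtain ⟨_, h1⟩ := h1 i
  obtain ⟨_, h2⟩ := h2 i
  exact Subtype.ext (h1.symm.trans h2)

/-- Since `T` commutes with cutoffs, the adjoint relation holds for integrals over every measurable
set, hence pointwise; testing against dense vectors of the fibre identifies `star T f` there. -/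
theorem IsDirectIntegral.adjoint (hJ : MeasurableRangeFunction J) (hT : IsDirectIntegral μ T R) :
    IsDirectIntegral μ (star T) fun x => star (R x) := by
  obtain ⟨F, hF⟩ := exists_seq_dense_fibres (μ := μ) hJ
  intro f
  have key : ∀ i, ∀ᵐ x ∂μ, ⟪(F i : Lp H 2 μ) x, (star T f : Lp H 2 μ) x⟫_ℂ
      = ⟪(T (F i) : Lp H 2 μ) x, (f : Lp H 2 μ) x⟫_ℂ := by
    intro i
    refine Integrable.ae_eq_of_forall_setIntegral_eq _ _ (L2.integrable_inner _ _)
      (L2.integrable_inner _ _) fun s hs _ => ?_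
    rw [← inner_cutoff_left _ _ hs, ← inner_cutoff_left _ _ hs, ← hT.map_cutoff,
      ContinuousLinearMap.star_eq_adjoint, ContinuousLinearMap.adjoint_inner_right]
  filter_upwards [hF, ae_all_iff.2 key, ae_all_iff.2 fun i => hT (F i), mem_rangeSpace.1 f.2,
    mem_rangeSpace.1 (star T f).2] with x ⟨hx, hd⟩ h1 h2 h3 h4
  refine ⟨h3, ?_⟩
  let w : (J x).toSubmodule := ⟨_, h4⟩
  suffices h : w = star (R x) ⟨_, h3⟩ from congrArg Subtype.val h
  refine ext_inner_left ℂ fun u => ?_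
  refine hd.induction_on (p := fun u => ⟪u, w⟫_ℂ = ⟪u, star (R x) ⟨_, h3⟩⟫_ℂ) u
    (isClosed_eq (by fun_prop) (by fun_prop)) fun i => ?_
  obtain ⟨_, h2⟩ := h2 i
  rw [ContinuousLinearMap.star_eq_adjoint, ContinuousLinearMap.adjoint_inner_right]
  refine (h1 i).trans ?_
  rw [h2]
  rfl

theorem IsDirectIntegral.le_norm_iff (hJ : MeasurableRangeFunction J)
    (hT : IsDirectIntegral μ T R) {r : ℝ} (hr : 0 ≤ r) :
    (∀ f, r * ‖f‖ ≤ ‖T f‖) ↔ ∀ᵐ x ∂μ, ∀ u, r * ‖u‖ ≤ ‖R x u‖ := by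
  constructor
  · intro h
    obtain ⟨F, hF⟩ := exists_seq_dense_fibres (μ := μ) hJ
    -- Squares are used because squared norms of cutoffs are set integrals, which can be compared
    -- pointwise.
    have key : ∀ i, ∀ᵐ x ∂μ, r ^ 2 * ‖(F i : Lp H 2 μ) x‖ ^ 2 ≤ ‖(T (F i) : Lp H 2 μ) x‖ ^ 2 := by
      intro i
      refine ae_le_of_forall_setIntegral_le
        (((Lp.memLp (F i : Lp H 2 μ)).integrable_norm_pow two_ne_zero).const_mul _)
        ((Lp.memLp (T (F i) : Lp H 2 μ)).integrable_norm_pow two_ne_zero) fun s hs _ => ?_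
      rw [integral_const_mul, ← norm_cutoff_sq _ hs, ← norm_cutoff_sq _ hs, ← hT.map_cutoff,
        ← mul_pow]
      gcongr
      exact h _
    filter_upwards [hF, ae_all_iff.2 key, ae_all_iff.2 fun i => hT (F i)] with x ⟨hx, hd⟩ h1 h2 u
    refine hd.induction_on (p := fun u => r * ‖u‖ ≤ ‖R x u‖) u
      (isClosed_le (by fun_prop) (by fun_prop)) fun i => ?_
    obtain ⟨_, h2⟩ := h2 i
    have h3 := h1 i
    rw [← mul_pow, h2] at h3
    exact le_of_sq_le_sq h3 (norm_nonneg _)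
  · intro h f
    have h1 : ‖(r : ℂ) • (f : Lp H 2 μ)‖ ≤ ‖(T f : Lp H 2 μ)‖ := by
      refine Lp.norm_le_norm_of_ae_le ?_
      filter_upwards [h, hT f, Lp.coeFn_smul (r : ℂ) (f : Lp H 2 μ)] with x hx ⟨h1, h2⟩ h3
      rw [h3, h2, Pi.smul_apply, norm_smul, Complex.norm_of_nonneg hr]
      exact hx ⟨_, h1⟩
    rwa [norm_smul, Complex.norm_of_nonneg hr] at h1

theorem IsDirectIntegral.ae_iff (hJ : MeasurableRangeFunction J) (hT : IsDirectIntegral μ T R)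
    (hS : IsDirectIntegral μ S Q) : T = S ↔ ∀ᵐ x ∂μ, R x = Q x :=
  ⟨fun h => hT.fibres_ae_eq hJ (h ▸ hS), hT.congr_fibres hS⟩

theorem IsDirectIntegral.isSelfAdjoint_iff (hJ : MeasurableRangeFunction J)
    (hT : IsDirectIntegral μ T R) : IsSelfAdjoint T ↔ ∀ᵐ x ∂μ, IsSelfAdjoint (R x) :=
  (hT.adjoint hJ).ae_iff hJ hT

theorem IsDirectIntegral.isStarNormal_iff (hJ : MeasurableRangeFunction J)
    (hT : IsDirectIntegral μ T R) : IsStarNormal T ↔ ∀ᵐ x ∂μ, IsStarNormal (R x) := by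
  simp only [_root_.isStarNormal_iff, commute_iff_eq]
  exact ((hT.adjoint hJ).comp hT).ae_iff hJ (hT.comp (hT.adjoint hJ))

theorem IsDirectIntegral.isStarNormal_and_spectrum_subset_iff (hJ : MeasurableRangeFunction J)
    (hT : IsDirectIntegral μ T R) {K : Set ℂ} (hK : IsClosed K) :
    (IsStarNormal T ∧ spectrum ℂ T ⊆ K) ↔
      ∀ᵐ x ∂μ, IsStarNormal (R x) ∧ spectrum ℂ (R x) ⊆ K := by
  rw [eventually_and, ← hT.isStarNormal_iff hJ]
  refine and_congr_right fun hN => ?_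
  have hN' := (hT.isStarNormal_iff hJ).1 hN
  rw [spectrum_subset_iff_le_norm hN hK, eventually_congr (hN'.mono fun x hx =>
    spectrum_subset_iff_le_norm hx hK)]
  simp only [eventually_all, ae_all_iff]
  refine forall₄_congr fun n q hq _ => ?_
  rw [(hT.sub_algebraMap _).le_norm_iff hJ (by exact_mod_cast hq.le)]

end DirectIntegral

end MultInv

theorem mainTheorem3
    {X : Type*} [MeasurableSpace X] (μ : MeasureTheory.Measure X) [MeasureTheory.SigmaFinite μ]
    [μ.IsComplete] [TopologicalSpace.SeparableSpace (MeasureTheory.Lp ℂ 2 μ)]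
    {H : Type*} [NormedAddCommGroup H] [InnerProductSpace ℂ H] [CompleteSpace H]
    [TopologicalSpace.SeparableSpace H]
    (V : ClosedSubmodule ℂ (MeasureTheory.Lp H 2 μ)) (hV : MultInv.IsMISpace μ V)
    (T : V.toSubmodule →L[ℂ] V.toSubmodule) (hT : MultInv.IsMIOperator μ hV T)
    (J : X → ClosedSubmodule ℂ H) (hJ : MultInv.MeasurableRangeFunction J)
    (hVJ : V = MultInv.rangeSpace μ J)
    (R : ∀ x, (J x).toSubmodule →L[ℂ] (J x).toSubmodule) (hRm : MultInv.MeasurableRangeOperator R)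
    (hRb : MultInv.BoundedRangeOperator μ R) (hTR : MultInv.IsDirectIntegral μ T R) :
    (∀ A B : ℝ, A ≤ B →
      ((IsSelfAdjoint T ∧ spectrum ℂ T ⊆ Complex.ofReal '' Set.Icc A B) ↔
        ∀ᵐ x ∂μ, IsSelfAdjoint (R x) ∧ spectrum ℂ (R x) ⊆ Complex.ofReal '' Set.Icc A B)) ∧
    (∀ K : Set ℂ, IsCompact K →
      ((IsStarNormal T ∧ spectrum ℂ T ⊆ K) ↔
        ∀ᵐ x ∂μ, IsStarNormal (R x) ∧ spectrum ℂ (R x) ⊆ K)) := by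
  subst hVJ
  refine ⟨fun A B _ => ?_, fun K hK =>
    hTR.isStarNormal_and_spectrum_subset_iff hJ hK.isClosed⟩
  have hK : IsCompact (Complex.ofReal '' Set.Icc A B) :=
    isCompact_Icc.image Complex.continuous_ofReal
  have key := hTR.isStarNormal_and_spectrum_subset_iff hJ hK.isClosed
  rw [eventually_and] at key ⊢
  rw [← hTR.isSelfAdjoint_iff hJ]
  -- Self-adjoint operators are normal, so only the spectral half of `key` remains to be used.
  refine and_congr_right fun hS => ?_
  have hS' := (hTR.isSelfAdjoint_iff hJ).1 hS
  rw [← hTR.isStarNormal_iff hJ] at key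
  exact (and_congr_right_iff.1 key) hS.isStarNormal
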